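/- **Setting.** Let $\mathcal P=\{P_1,\dots,P_n\}$ and let $\mathcal Z$ be a family of subsets of $\mathcal P$ (adversary structure; below, "$A\in\mathcal Z$" for a set of parties $A$ means that $A$ is contained in some member of the family, which is plain membership when $\mathcal Z$ is closed under subsets). An adversary corrupts, from the start, some set $Z_c\in\mathcal Z$; corrupt parties behave arbitrarily. Assume $\mathcal Q^{(3)}(\mathcal P,\mathcal Z)$: no three members of $\mathcal Z$ cover $\mathcal P$. Let $\Delta>0$. In a *synchronous* network the local clocks are synchronized and every message between honest parties is delivered within time $\Delta$. In an *asynchronous* network the local clocks are arbitrary and every message between honest parties is delivered eventually. Times at which a party acts are local times. **Acast** (sender $\mathsf S$, input $m$). At time $0$, $\mathsf S$ sends $(\mathtt{init},m)$ to all parties. On receiving $(\mathtt{init},m')$ from $\mathsf S$, send $(\mathtt{echo},m')$ to all (at most once). On receiving $(\mathtt{echo},m')$ from all parties of $\mathcal P\setminus Z$ for some $Z\in\mathcal Z$, or $(\mathtt{ready},m')$ from a set $C\notin\mathcal Z$, send $(\mathtt{ready},m')$ to all (once). On receiving $(\mathtt{ready},m')$ from all parties of $\mathcal P\setminus Z$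 for some $Z\in\mathcal Z$, output $m'$ (this output is final). Parties keep participating forever. **$\Pi_{\mathsf{SBA}}$** (on bits). Let $K_1,\dots,K_\kappa$ be publicly known, pairwise different parties ("kings") with $\{K_1,\dots,K_\kappa\}\notin\mathcal Z$. Each $P_i$ sets $\mathsf{pref}_i$ to its input bit; there are $\kappa$ phases of three rounds of length $\Delta$. In phase $k$, started at local time $s$: (1) at time $s$, send $\mathsf{pref}_i$ to all. (2) At time $s+\Delta$, if some bit $b$ has been received as preference from all parties of $\mathcal P\setminus Z$ for some $Z\in\mathcal Z$, send $(\mathsf{propose},b)$ to all. At time $s+2\Delta$, if $(\mathsf{propose},b)$ has been received from a set $C\notin\mathcal Z$, set $\mathsf{pref}_i=b$. (3) At time $s+2\Delta$ the king $K_k$ sends its current preference to all. (4) At time $s+3\Delta$, if $(\mathsf{propose},b)$ had been received by time $s+2\Delta$ from all parties of $\mathcal P\setminus Z$ for some $Z\in\mathcal Z$, set $\mathsf{pref}_i=b$; else set $\mathsf{pref}_i$ to the bit received from the king (if none was received, keep $\mathsf{pref}_i$). After the last phase output $\mathsf{pref}_i$. The duration is $T_{\mathsf{SBA}}=3\kappa\Delta$.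 For inputs in $\{0,1\}^\ell\cup\{\bot\}$, encoded by $\ell+1$ bits (a flag telling whether the value is $\bot$, and $\ell$ message bits), $\ell+1$ instances run in parallel. **$\Pi_{\mathsf{BC}}$.** The sender $\mathsf S$ Acasts its input $m\in\{0,1\}^\ell$. At time $3\Delta$ each party starts $\Pi_{\mathsf{SBA}}$ with input the message received from the Acast of $\mathsf S$, or $\bot$ if there is none yet. *Regular mode:* at time $T_{\mathsf{BC}}=3\Delta+T_{\mathsf{SBA}}$ each party outputs $m^\star\neq\bot$ if $m^\star$ has been received from the Acast of $\mathsf S$ and is its output of $\Pi_{\mathsf{SBA}}$; otherwise it outputs $\bot$. *Fallback mode:* after time $T_{\mathsf{BC}}$, a party with output $\bot$ changes it to $m^\star$ if and when it has received $m^\star$ from the Acast of $\mathsf S$. Other outputs are never changed. **Theorem.** Under these assumptions $T_{\mathsf{BC}}=3\Delta+T_{\mathsf{SBA}}$ with $T_{\mathsf{SBA}}\le 3n\Delta$, and every execution of $\Pi_{\mathsf{BC}}$ satisfies the following. *Synchronous network.* (a) Liveness: at time $T_{\mathsf{BC}}$ each honest party has an output (in $\{0,1\}^\ell\cup\{\bot\}$).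 (b) Validity: if $\mathsf S$ is honest, each honest party outputs $m$ at time $T_{\mathsf{BC}}$. (c) Consistency: if $\mathsf S$ is corrupt, all honest parties have the same output at time $T_{\mathsf{BC}}$. (d) Fallback consistency: if $\mathsf S$ is corrupt and some honest party has output $m^\star\ne\bot$ at time $T$ through fallback mode, then every honest party outputs $m^\star$ by time $T+2\Delta$. *Asynchronous network* (times are local). (a) Liveness: at time $T_{\mathsf{BC}}$ each honest party has an output. (b) Weak validity: if $\mathsf S$ is honest, each honest party outputs $m$ or $\bot$ at time $T_{\mathsf{BC}}$. (c) Fallback validity: if $\mathsf S$ is honest, each honest party with output $\bot$ at time $T_{\mathsf{BC}}$ eventually outputs $m$ through fallback mode. (d) Weak consistency: if $\mathsf S$ is corrupt, there is a common $m^\star\neq\bot$ such that each honest party outputs $m^\star$ or $\bot$ at time $T_{\mathsf{BC}}$. (e) Fallback consistency: if $\mathsf S$ is corrupt and some honest party has output $m^\star\ne\bot$ at a time $T\ge T_{\mathsf{BC}}$, then each honest party eventually outputs $m^\star$. *Communication.* In either network, if $\ell\ge1$, the honest parties send $\mathcal O(n^3\ell)$ bits in total, with an absolute constant. Here the length of a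 message is a constant number of bits for its kind plus the length of its content ($\ell$ bits in Acast, one bit per instance in $\Pi_{\mathsf{SBA}}$); phase and instance numbers are not counted. -/

import Mathlib

/-!
Reliable broadcast with fallback among `n` parties, in a synchronous or an asynchronous network,
against a general adversary.

All protocols involved are deterministic, so the claims are about every execution. An execution is
described by the times at which messages are sent by the honest parties and received from
anybody. Each message carries enough tags (protocol step, phase, instance) to be sent at most once
by an honest party, and a recipient ignores repetitions, so that it is enough to record the time at
which a message is first received from a given party.
-/

namespace BestOfBothBC

/-- Messages of `ℓ` bits. -/
abbrev Bits (ℓ : ℕ) : Type := Fin ℓ → Bool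

/-- An adversary structure on `Fin n` is given by a family `Z` of sets of parties; a set of parties
can be corrupted when it is contained in some member of `Z`. (For a family that is closed under
subsets this says that it is a member of `Z`.) -/
def Corruptible {n : ℕ} (Z : Set (Finset (Fin n))) (A : Set (Fin n)) : Prop :=
  ∃ z ∈ Z, ∀ j ∈ A, j ∈ z

/-- The `Q^(k)` condition: no `k` sets from `Z` cover the set of all parties. -/
def QCondition {n : ℕ} (k : ℕ) (Z : Set (Finset (Fin n))) : Prop :=
  ∀ F : Fin k → Finset (Fin n), (∀ a, F a ∈ Z) → ∃ j, ∀ a, j ∉ F a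

/-- `A` contains the complement of some member of `Z`. -/
def ContainsCompl {n : ℕ} (Z : Set (Finset (Fin n))) (A : Set (Fin n)) : Prop :=
  ∃ z ∈ Z, ∀ j, j ∉ z → j ∈ A

/-- Public data of a run of the broadcast protocol, and the input of the sender. -/
structure Params where
  /-- number of parties -/
  n : ℕ
  /-- length of the message of the sender -/
  ell : ℕ
  /-- adversary structure -/
  Z : Set (Finset (Fin n))
  /-- the sender -/
  S : Fin n
  /-- the input of the sender -/
  m : Bits ell
  /-- the delay bound `Δ` of a synchronous network -/
  Δ : ℝ
  /-- number of phases (and of kings) of the Byzantine agreement protocol -/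
  κ : ℕ
  /-- the king of each phase -/
  king : Fin κ → Fin n

namespace Params

/-- The kings are pairwise different and the set of all kings cannot be corrupted. -/
def KingsValid (p : Params) : Prop :=
  Function.Injective p.king ∧ ¬ Corruptible p.Z (Set.range p.king)

/-- Duration of the synchronous Byzantine agreement protocol: three rounds in each phase. -/
noncomputable def TSBA (p : Params) : ℝ := 3 * p.κ * p.Δ

/-- Time at which the regular mode of the broadcast protocol produces its output. -/
noncomputable def TBC (p : Params) : ℝ := 3 * p.Δ + p.TSBA

/-- Time at which phase `k` of the Byzantine agreement starts (phases are numbered from `0`). -/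
noncomputable def phaseStart (p : Params) (k : ℕ) : ℝ := 3 * p.Δ + 3 * k * p.Δ

end Params

/-- The messages. The first three belong to Acast. The others belong to the Byzantine agreement,
which works on single bits: the values `m` or `⊥` are encoded by `ℓ + 1` bits, and `ℓ + 1` instances
run in parallel, instance `none` for the flag that distinguishes `m` from `⊥` and instance `some a`
for bit `a` of the message. The argument `k` is the phase, `c` is the instance. -/
inductive Msg (ell κ : ℕ) : Type
  | init (m : Bits ell)
  | echo (m : Bits ell)
  | ready (m : Bits ell)
  | pref (k : Fin κ) (c : Option (Fin ell)) (b : Bool)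
  | propose (k : Fin κ) (c : Option (Fin ell)) (b : Bool)
  | king (k : Fin κ) (c : Option (Fin ell)) (b : Bool)
  deriving DecidableEq, Fintype

/-- Length of a message: three bits for its kind, and its content. The numbers of the phase and of
the instance are identifiers that are not charged. -/
def Msg.bits {ell κ : ℕ} : Msg ell κ → ℕ
  | .init _ => 3 + ell
  | .echo _ => 3 + ell
  | .ready _ => 3 + ell
  | .pref _ _ _ => 3 + 1
  | .propose _ _ _ => 3 + 1
  | .king _ _ _ => 3 + 1

/-- Encoding of a message or `⊥` (here `none`) by `ℓ + 1` bits. -/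
def encode {ell : ℕ} (x : Option (Bits ell)) : Option (Fin ell) → Bool
  | none => x.isSome
  | some a => x.getD (fun _ => false) a

/-- Decoding of `ℓ + 1` bits. -/
def decode {ell : ℕ} (f : Option (Fin ell) → Bool) : Option (Bits ell) :=
  if f none then some (fun a => f (some a)) else none

open Classical in
/-- A bit that satisfies `q`, if there is one. -/
noncomputable def pick (q : Bool → Prop) : Option Bool :=
  if q true then some true else if q false then some false else none

/-- The data of an execution. Times of events at party `i` are readings of the local clock of `i`,
and `⊤` stands for an event that never happens. The data of corrupt parties are without meaning,
except that `recv i j x` for honest `i` and corrupt `j` tells what `j` did towards `i`. -/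
structure Execution (p : Params) where
  /-- the corrupt parties, fixed throughout the execution -/
  corrupt : Finset (Fin p.n)
  /-- `clock i t` is the real time at which the local clock of party `i` shows `t` -/
  clock : Fin p.n → ℝ ≃o ℝ
  /-- `sent i x`: when party `i` sends `x` to all the parties (including itself) -/
  sent : Fin p.n → Msg p.ell p.κ → WithTop ℝ
  /-- `recv i j x`: when party `i` first receives `x` from party `j` -/
  recv : Fin p.n → Fin p.n → Msg p.ell p.κ → WithTop ℝ
  /-- `acast i t`: the output that party `i` has from Acast at time `t` (`none` if it has none) -/
  acast : Fin p.n → ℝ → Option (Bits p.ell)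

namespace Execution

variable {p : Params}

/-- Honest means not corrupt. -/
def Honest (e : Execution p) (i : Fin p.n) : Prop := i ∉ e.corrupt

/-- The parties from which `i` has received `x` by time `t`. -/
def senders (e : Execution p) (i : Fin p.n) (x : Msg p.ell p.κ) (t : ℝ) : Set (Fin p.n) :=
  {j | e.recv i j x ≤ (t : WithTop ℝ)}

/-- The bit that `i` proposes in step 2 of phase `k` of instance `c`, if any: the bit received
as preference from all the parties outside some member of `Z`. -/
noncomputable def proposal (e : Execution p) (i : Fin p.n) (k : Fin p.κ)
    (c : Option (Fin p.ell)) : Option Bool :=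
  pick fun b => ContainsCompl p.Z (e.senders i (.pref k c b) (p.phaseStart k + p.Δ))

/-- Update of the preference `b₀` of `i` at the end of step 2 of phase `k`: the bit proposed by a
set of parties that cannot be corrupted, if there is one. -/
noncomputable def midPref (e : Execution p) (i : Fin p.n) (k : Fin p.κ)
    (c : Option (Fin p.ell)) (b₀ : Bool) : Bool :=
  (pick fun b =>
    ¬ Corruptible p.Z (e.senders i (.propose k c b) (p.phaseStart k + 2 * p.Δ))).getD b₀

/-- The preference of `i` for the next phase, fixed in step 4 of phase `k`: the bit proposed during
step 2 by all the parties outside some member of `Z`, if there is one, else the bit received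
from the king, if there is one, else the current preference `b₁`. -/
noncomputable def endPref (e : Execution p) (i : Fin p.n) (k : Fin p.κ)
    (c : Option (Fin p.ell)) (b₁ : Bool) : Bool :=
  ((pick fun b =>
      ContainsCompl p.Z (e.senders i (.propose k c b) (p.phaseStart k + 2 * p.Δ))).orElse
    fun _ => pick fun b =>
      p.king k ∈ e.senders i (.king k c b) (p.phaseStart k + 3 * p.Δ)).getD b₁

/-- The preference of `i` in instance `c` at the start of phase `k`. The agreement starts at
time `3Δ`, with what `i` has then received through Acast, or `⊥`, as input. -/
noncomputable def prefAt (e : Execution p) (i : Fin p.n) (c : Option (Fin p.ell)) :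
    (k : ℕ) → k ≤ p.κ → Bool
  | 0, _ => encode (e.acast i (3 * p.Δ)) c
  | k + 1, h =>
      e.endPref i ⟨k, h⟩ c (e.midPref i ⟨k, h⟩ c (prefAt e i c k (Nat.le_of_succ_le h)))

/-- The output of `i` from the Byzantine agreement; it is available at time `T_BC`. -/
noncomputable def sbaOut (e : Execution p) (i : Fin p.n) : Option (Bits p.ell) :=
  decode fun c => e.prefAt i c p.κ le_rfl

open Classical in
/-- The value that `i` outputs at time `T_BC` (regular mode): the message received through Acast
by then, provided that it is also the output of the Byzantine agreement, else `⊥`. -/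
noncomputable def regularOut (e : Execution p) (i : Fin p.n) : Option (Bits p.ell) :=
  if e.acast i p.TBC = e.sbaOut i then e.acast i p.TBC else none

open Classical in
/-- The output of `i` from the broadcast protocol at local time `t`. The outer `none` means that
there is no output, and `some none` is the output `⊥`. After time `T_BC` (fallback mode), an
output `⊥` is replaced by the message received through Acast, once there is one, and any other
output is kept. -/
noncomputable def out (e : Execution p) (i : Fin p.n) (t : ℝ) : Option (Option (Bits p.ell)) :=
  if t < p.TBC then none
  else if t = p.TBC then some (e.regularOut i)
  else some ((e.regularOut i).orElse fun _ => e.acast i t)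

open Classical in
/-- Party `i` follows the protocol. In Acast a message is reacted to as soon as it is received,
for ever; in the Byzantine agreement the actions are scheduled by the local clock. -/
structure Follows (e : Execution p) (i : Fin p.n) : Prop where
  /-- the sender, and nobody else, sends its input as initial message at time `0` -/
  init : ∀ x, e.sent i (.init x) = if i = p.S ∧ x = p.m then ((0 : ℝ) : WithTop ℝ) else ⊤
  /-- only an initial message that has just come from the sender is echoed, -/
  echo_sound : ∀ x (t : ℝ), e.sent i (.echo x) = t → e.recv i p.S (.init x) = t
  /-- at most one message is echoed, -/
  echo_once : ∀ x y, e.sent i (.echo x) ≠ ⊤ → e.sent i (.echo y) ≠ ⊤ → x = y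
  /-- and once an initial message has come, there is an echo -/
  echo_live : ∀ x (t : ℝ), e.recv i p.S (.init x) = t → ∃ y, e.sent i (.echo y) ≤ (t : WithTop ℝ)
  /-- `ready` is sent as soon as there are enough `echo` or enough `ready` messages -/
  ready : ∀ x (t : ℝ), e.sent i (.ready x) ≤ (t : WithTop ℝ) ↔
    ContainsCompl p.Z (e.senders i (.echo x) t) ∨ ¬ Corruptible p.Z (e.senders i (.ready x) t)
  /-- an output of Acast comes from `ready` messages, -/
  acast_some : ∀ x t, e.acast i t = some x → ContainsCompl p.Z (e.senders i (.ready x) t)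
  /-- is produced as soon as there are enough of these, -/
  acast_live : ∀ x t, ContainsCompl p.Z (e.senders i (.ready x) t) → e.acast i t ≠ none
  /-- and is final -/
  acast_final : ∀ x t t', t ≤ t' → e.acast i t = some x → e.acast i t' = some x
  /-- step 1 of phase `k`: send the preference -/
  pref : ∀ k c b, e.sent i (.pref k c b) =
    if e.prefAt i c k k.isLt.le = b then (p.phaseStart k : WithTop ℝ) else ⊤
  /-- step 2 of phase `k`: send the proposal, if any -/
  propose : ∀ k c b, e.sent i (.propose k c b) =
    if e.proposal i k c = some b then ((p.phaseStart k + p.Δ : ℝ) : WithTop ℝ) else ⊤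
  /-- step 3 of phase `k`: the king sends its updated preference -/
  king : ∀ k c b, e.sent i (.king k c b) =
    if i = p.king k ∧ e.midPref i k c (e.prefAt i c k k.isLt.le) = b
    then ((p.phaseStart k + 2 * p.Δ : ℝ) : WithTop ℝ) else ⊤

/-- The executions in an asynchronous network: the corrupt parties are permitted by the adversary
structure and behave arbitrarily, the honest parties follow the protocol, and every message sent
between honest parties is eventually delivered. Nothing is received before it is sent; local clocks
are arbitrary, and a party receives messages only from time `0` of its clock on. -/
structure Async (e : Execution p) : Prop where
  corrupt_mem : Corruptible p.Z {i | i ∈ e.corrupt}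
  follows : ∀ i, e.Honest i → e.Follows i
  recv_nonneg : ∀ i, e.Honest i → ∀ j x, 0 ≤ e.recv i j x
  authentic : ∀ i j, e.Honest i → e.Honest j → ∀ x (t : ℝ), e.recv i j x = t →
    ∃ s : ℝ, e.sent j x = s ∧ e.clock j s < e.clock i t
  delivered : ∀ i j, e.Honest i → e.Honest j → ∀ x, e.sent j x ≠ ⊤ → e.recv i j x ≠ ⊤

/-- The executions in a synchronous network: in addition, the clocks are synchronized, and messages
between honest parties are delivered within time `Δ`. -/
structure Sync (e : Execution p) : Prop extends Async e where
  clock_eq : ∀ i t, e.clock i t = t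
  delay : ∀ i j, e.Honest i → e.Honest j → ∀ x (s : ℝ), e.sent j x = s →
    e.recv i j x ≤ ((s + p.Δ : ℝ) : WithTop ℝ)

open Classical in
/-- The number of bits sent by the honest parties; every message goes to `n` recipients. -/
noncomputable def honestBits (e : Execution p) : ℕ :=
  ∑ i ∈ Finset.univ.filter e.Honest, ∑ x : Msg p.ell p.κ,
    if e.sent i x = ⊤ then 0 else p.n * x.bits

/-- Party `i` has output `x` at time `t`, obtained through the fallback mode. -/
def FallbackOutput (e : Execution p) (i : Fin p.n) (t : ℝ) (x : Bits p.ell) : Prop :=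
  p.TBC < t ∧ e.out i p.TBC = some none ∧ e.out i t = some (some x)

/-- From some time on, the output of party `i` is `x`. -/
def EventuallyOutputs (e : Execution p) (i : Fin p.n) (x : Bits p.ell) : Prop :=
  ∃ t₀ : ℝ, ∀ t, t₀ ≤ t → e.out i t = some (some x)

end Execution

end BestOfBothBC

namespace BestOfBothBC

open Filter

/-! ### Quorums -/

/-! Everything rests on three facts about quorums, that is, sets containing the complement of a
member of `Z`. Under `Q^(3)` two quorums share an honest party, and the honest part of a quorum is
not corruptible; any set that is not corruptible contains an honest party.

Acast: the first honest `ready` for a message rests on a quorum of `echo`s, and honest parties echo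
once, so all honest `ready`s carry one message (`Async.ready_unique`). An honest output rests on a
quorum of `ready`s, whose honest part triggers `ready` at every honest party, hence outputs
everywhere: eventually in general (`Async.exists_acast_of_acast`), within `2Δ` under synchrony
(`Sync.acast_of_acast`). An honest sender's message arrives by `3Δ` under synchrony.

Byzantine agreement, under synchrony: honest proposals in a phase and instance never conflict,
agreement among honest parties persists (`Sync.prefAt_of_agree`), and a phase with an honest king
creates it (`Sync.exists_agree_of_king`). Such a phase exists because the kings cannot all be
corrupt.

Broadcast: after `T_BC` the output is just the Acast output (`Async.out_of_lt`), so the fallback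
claims are Acast claims. Consistency at `T_BC` is `Sync.regularOut_eq`: an agreed value other than
`⊥` forces some honest party to have an Acast output by `3Δ`, so all have it by `5Δ ≤ T_BC`. -/

theorem QCondition.exists_notMem {n : ℕ} {Z : Set (Finset (Fin n))} (hQ : QCondition 3 Z)
    {z₁ z₂ z₃ : Finset (Fin n)} (h₁ : z₁ ∈ Z) (h₂ : z₂ ∈ Z) (h₃ : z₃ ∈ Z) :
    ∃ j, j ∉ z₁ ∧ j ∉ z₂ ∧ j ∉ z₃ := by
  obtain ⟨j, hj⟩ := hQ ![z₁, z₂, z₃] (by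
    intro a
    fin_cases a
    exacts [h₁, h₂, h₃])
  exact ⟨j, hj 0, hj 1, hj 2⟩

theorem Corruptible.mono {n : ℕ} {Z : Set (Finset (Fin n))} {A B : Set (Fin n)} (hAB : A ⊆ B)
    (h : Corruptible Z B) : Corruptible Z A :=
  let ⟨z, hz, hB⟩ := h
  ⟨z, hz, fun j hj => hB j (hAB hj)⟩

theorem eq_some_of_pick {q : Bool → Prop} {b : Bool} (h : pick q = some b) : q b := by
  unfold pick at h
  split_ifs at h with h₁ h₂ <;> cases h <;> assumption

theorem not_of_pick_eq_none {q : Bool → Prop} (h : pick q = none) (b : Bool) : ¬ q b := by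
  unfold pick at h
  split_ifs at h with h₁ h₂
  cases b <;> assumption

theorem pick_eq_some {q : Bool → Prop} {b : Bool} (hb : q b) (hu : ∀ b', q b' → b' = b) :
    pick q = some b := by
  cases h : pick q with
  | none => exact absurd hb (not_of_pick_eq_none h b)
  | some b' => rw [hu b' (eq_some_of_pick h)]

namespace Execution

variable {p : Params} {e : Execution p}

/-! ### Facts that need no timing assumption, valid in both networks. -/

namespace Async

variable (h : e.Async)
include h

theorem exists_honest_of_not_corruptible {A : Set (Fin p.n)} (hA : ¬ Corruptible p.Z A) :
    ∃ j ∈ A, e.Honest j := by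
  by_contra! hc
  exact hA (h.corrupt_mem.mono fun j hj => not_not.1 (hc j hj))

theorem containsCompl_of_honest {A : Set (Fin p.n)} (hA : ∀ j, e.Honest j → j ∈ A) :
    ContainsCompl p.Z A := by
  obtain ⟨z, hz, hc⟩ := h.corrupt_mem
  exact ⟨z, hz, fun j hj => hA j fun hj' => hj (hc j hj')⟩

theorem exists_honest_mem_inter (hQ : QCondition 3 p.Z) {A B : Set (Fin p.n)}
    (hA : ContainsCompl p.Z A) (hB : ContainsCompl p.Z B) : ∃ j, e.Honest j ∧ j ∈ A ∧ j ∈ B := by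
  obtain ⟨z, hz, hc⟩ := h.corrupt_mem
  obtain ⟨z₁, hz₁, h₁⟩ := hA
  obtain ⟨z₂, hz₂, h₂⟩ := hB
  obtain ⟨j, hj, hj₁, hj₂⟩ := hQ.exists_notMem hz hz₁ hz₂
  exact ⟨j, fun hj' => hj (hc j hj'), h₁ j hj₁, h₂ j hj₂⟩

theorem not_corruptible_of_honest_subset (hQ : QCondition 3 p.Z) {A B : Set (Fin p.n)}
    (hA : ContainsCompl p.Z A) (hAB : ∀ j ∈ A, e.Honest j → j ∈ B) : ¬ Corruptible p.Z B := by
  rintro ⟨z₂, hz₂, h₂⟩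
  obtain ⟨z, hz, hc⟩ := h.corrupt_mem
  obtain ⟨z₁, hz₁, h₁⟩ := hA
  obtain ⟨j, hj, hj₁, hj₂⟩ := hQ.exists_notMem hz hz₁ hz₂
  exact hj₂ (h₂ j (hAB j (h₁ j hj₁) fun hj' => hj (hc j hj')))

theorem exists_honest_mem (hQ : QCondition 3 p.Z) {A : Set (Fin p.n)}
    (hA : ContainsCompl p.Z A) : ∃ j ∈ A, e.Honest j :=
  let ⟨j, hj, hjA, _⟩ := h.exists_honest_mem_inter hQ hA hA
  ⟨j, hjA, hj⟩

theorem sent_ne_top {i j : Fin p.n} (hi : e.Honest i) (hj : e.Honest j) {x : Msg p.ell p.κ} {t : ℝ}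
    (hx : j ∈ e.senders i x t) : e.sent j x ≠ ⊤ := by
  obtain ⟨r, hr, -⟩ := WithTop.le_coe_iff.1 hx
  obtain ⟨s, hs, -⟩ := h.authentic i j hi hj x r hr
  simp [hs]

/-! ### Acast -/

/-- Among the honest senders of this `ready`, take the earliest in real time. It cannot have been
triggered by other `ready`s: a set that is not corruptible contains an honest party, which would
have sent strictly earlier. -/
theorem exists_echo_quorum {i : Fin p.n} (hi : e.Honest i) {x : Bits p.ell}
    (hx : e.sent i (.ready x) ≠ ⊤) :
    ∃ i t, e.Honest i ∧ ContainsCompl p.Z (e.senders i (.echo x) t) := by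
  classical
  obtain ⟨j, hj, hmin⟩ := Finset.exists_min_image
    (Finset.univ.filter fun j => e.Honest j ∧ e.sent j (.ready x) ≠ ⊤)
    -- Local times are comparable only through `clock`; the default `0` is never used, as the filter
    -- keeps only parties that do send.
    (fun j => e.clock j ((e.sent j (.ready x)).untopD 0)) ⟨i, by simp [hi, hx]⟩
  obtain ⟨hj, hjx⟩ := (Finset.mem_filter.1 hj).2
  obtain ⟨t, ht⟩ := WithTop.ne_top_iff_exists.1 hjx
  rcases ((h.follows j hj).ready x t).1 ht.ge with hq | hq
  · exact ⟨j, t, hj, hq⟩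
  · obtain ⟨a, ha, hah⟩ := h.exists_honest_of_not_corruptible hq
    obtain ⟨r, hr, hrt⟩ := WithTop.le_coe_iff.1 ha
    obtain ⟨s, hs, hlt⟩ := h.authentic j a hj hah _ r hr
    have := hmin a (by simp [hah, hs])
    rw [hs, ← ht] at this
    exact absurd ((hlt.trans_le ((e.clock j).monotone hrt))) (not_lt.2 this)

theorem ready_unique (hQ : QCondition 3 p.Z) {i j : Fin p.n} (hi : e.Honest i) (hj : e.Honest j)
    {x y : Bits p.ell} (hx : e.sent i (.ready x) ≠ ⊤) (hy : e.sent j (.ready y) ≠ ⊤) : x = y := by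
  obtain ⟨i', t, hi', hx'⟩ := h.exists_echo_quorum hi hx
  obtain ⟨j', t', hj', hy'⟩ := h.exists_echo_quorum hj hy
  obtain ⟨a, ha, hax, hay⟩ := h.exists_honest_mem_inter hQ hx' hy'
  exact (h.follows a ha).echo_once x y (h.sent_ne_top hi' ha hax) (h.sent_ne_top hj' ha hay)

theorem exists_ready_of_acast (hQ : QCondition 3 p.Z) {i : Fin p.n} (hi : e.Honest i)
    {x : Bits p.ell} {t : ℝ} (hx : e.acast i t = some x) :
    ∃ j, e.Honest j ∧ e.sent j (.ready x) ≠ ⊤ := by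
  obtain ⟨j, hjx, hj⟩ := h.exists_honest_mem hQ ((h.follows i hi).acast_some x t hx)
  exact ⟨j, hj, h.sent_ne_top hi hj hjx⟩

theorem acast_unique (hQ : QCondition 3 p.Z) {i j : Fin p.n} (hi : e.Honest i) (hj : e.Honest j)
    {x y : Bits p.ell} {s t : ℝ} (hx : e.acast i s = some x) (hy : e.acast j t = some y) :
    x = y := by
  obtain ⟨a, ha, hax⟩ := h.exists_ready_of_acast hQ hi hx
  obtain ⟨b, hb, hby⟩ := h.exists_ready_of_acast hQ hj hy
  exact h.ready_unique hQ ha hb hax hby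

theorem echo_eq_input (hS : e.Honest p.S) {i : Fin p.n} (hi : e.Honest i) {x : Bits p.ell}
    (hx : e.sent i (.echo x) ≠ ⊤) : x = p.m := by
  obtain ⟨t, ht⟩ := WithTop.ne_top_iff_exists.1 hx
  obtain ⟨s, hs, -⟩ := h.authentic i p.S hi hS _ t ((h.follows i hi).echo_sound x t ht.symm)
  rw [(h.follows p.S hS).init] at hs
  by_contra hne
  simp [hne] at hs

theorem ready_eq_input (hQ : QCondition 3 p.Z) (hS : e.Honest p.S) {i : Fin p.n}
    (hi : e.Honest i) {x : Bits p.ell} (hx : e.sent i (.ready x) ≠ ⊤) : x = p.m := by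
  obtain ⟨j, t, hj, hq⟩ := h.exists_echo_quorum hi hx
  obtain ⟨a, hax, ha⟩ := h.exists_honest_mem hQ hq
  exact h.echo_eq_input hS ha (h.sent_ne_top hj ha hax)

theorem acast_eq_input (hQ : QCondition 3 p.Z) (hS : e.Honest p.S) {i : Fin p.n}
    (hi : e.Honest i) {x : Bits p.ell} {t : ℝ} (hx : e.acast i t = some x) : x = p.m := by
  obtain ⟨j, hj, hjx⟩ := h.exists_ready_of_acast hQ hi hx
  exact h.ready_eq_input hQ hS hj hjx

/-- An `echo` of an honest party, once the initial message of an honest sender has come. -/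
theorem echo_le (hS : e.Honest p.S) {i : Fin p.n} (hi : e.Honest i) {t : ℝ}
    (ht : e.recv i p.S (.init p.m) ≤ (t : WithTop ℝ)) : e.sent i (.echo p.m) ≤ (t : WithTop ℝ) := by
  obtain ⟨r, hr, hrt⟩ := WithTop.le_coe_iff.1 ht
  obtain ⟨y, hy⟩ := (h.follows i hi).echo_live _ r hr
  have hy' := h.echo_eq_input hS hi (ne_top_of_le_ne_top WithTop.coe_ne_top hy)
  subst hy'
  exact hy.trans (WithTop.coe_le_coe.2 hrt)

theorem acast_of_ready_quorum (hQ : QCondition 3 p.Z) {i : Fin p.n} (hi : e.Honest i)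
    {x : Bits p.ell} {t : ℝ} (hq : ContainsCompl p.Z (e.senders i (.ready x) t)) :
    e.acast i t = some x := by
  -- `acast_live` promises only some output `y`; uniqueness of honest `ready`s identifies it with
  -- `x`.
  obtain ⟨y, hy⟩ := Option.ne_none_iff_exists'.1 ((h.follows i hi).acast_live x t hq)
  obtain ⟨j, hjx, hj⟩ := h.exists_honest_mem hQ hq
  obtain ⟨a, ha, hay⟩ := h.exists_ready_of_acast hQ hi hy
  rw [hy, h.ready_unique hQ ha hj hay (h.sent_ne_top hi hj hjx)]

theorem exists_time_received {i : Fin p.n} (hi : e.Honest i) (x : Msg p.ell p.κ) :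
    ∃ t : ℝ, ∀ j, e.Honest j → e.sent j x ≠ ⊤ → j ∈ e.senders i x t := by
  have hev : ∀ᶠ t : ℝ in atTop, ∀ j, e.Honest j → e.sent j x ≠ ⊤ → j ∈ e.senders i x t := by
    refine eventually_all.2 fun j => ?_
    by_cases hj : e.Honest j ∧ e.sent j x ≠ ⊤
    · obtain ⟨r, hr⟩ := WithTop.ne_top_iff_exists.1 (h.delivered i j hi hj.1 x hj.2)
      filter_upwards [eventually_ge_atTop r] with t ht _ _
      exact hr.symm.le.trans (WithTop.coe_le_coe.2 ht)
    · exact Eventually.of_forall fun t h₁ h₂ => absurd ⟨h₁, h₂⟩ hj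
  exact hev.exists

theorem exists_acast_of_ready (hQ : QCondition 3 p.Z) {x : Bits p.ell}
    (hx : ∀ j, e.Honest j → e.sent j (.ready x) ≠ ⊤) {i : Fin p.n} (hi : e.Honest i) :
    ∃ t, e.acast i t = some x := by
  obtain ⟨t, ht⟩ := h.exists_time_received hi (.ready x)
  exact ⟨t, h.acast_of_ready_quorum hQ hi (h.containsCompl_of_honest fun j hj => ht j hj (hx j hj))⟩

/-- Amplification: the honest parties behind the output of `i` form a set that is not corruptible,
and their `ready`s eventually reach everybody, so every honest party sends `ready` too. -/
theorem exists_acast_of_acast (hQ : QCondition 3 p.Z) {i j : Fin p.n} (hi : e.Honest i)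
    (hj : e.Honest j) {x : Bits p.ell} {s : ℝ} (hx : e.acast i s = some x) :
    ∃ t, e.acast j t = some x := by
  refine h.exists_acast_of_ready hQ (fun a ha => ?_) hj
  obtain ⟨t, ht⟩ := h.exists_time_received ha (.ready x)
  refine ne_top_of_le_ne_top WithTop.coe_ne_top (((h.follows a ha).ready x t).2 (Or.inr ?_))
  exact h.not_corruptible_of_honest_subset hQ ((h.follows i hi).acast_some x s hx)
    fun b hb hbh => ht b hbh (h.sent_ne_top hi hbh hb)

theorem exists_acast_input (hQ : QCondition 3 p.Z) (hS : e.Honest p.S) {i : Fin p.n}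
    (hi : e.Honest i) : ∃ t, e.acast i t = some p.m := by
  have hecho : ∀ j, e.Honest j → e.sent j (.echo p.m) ≠ ⊤ := fun j hj => by
    obtain ⟨r, hr⟩ := WithTop.ne_top_iff_exists.1
      (h.delivered j p.S hj hS (.init p.m) (by simp [(h.follows p.S hS).init]))
    exact ne_top_of_le_ne_top WithTop.coe_ne_top (h.echo_le hS hj hr.symm.le)
  refine h.exists_acast_of_ready hQ (fun j hj => ?_) hi
  obtain ⟨t, ht⟩ := h.exists_time_received hj (.echo p.m)
  exact ne_top_of_le_ne_top WithTop.coe_ne_top (((h.follows j hj).ready _ t).2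
    (Or.inl (h.containsCompl_of_honest fun a ha => ht a ha (hecho a ha))))

/-! ### Byzantine agreement -/

theorem eq_of_pref {i j : Fin p.n}
    (hi : e.Honest i) (hj : e.Honest j) {k : Fin p.κ} {c : Option (Fin p.ell)} {b : Bool} {t : ℝ}
    (hx : j ∈ e.senders i (.pref k c b) t) : e.prefAt j c k k.isLt.le = b := by
  by_contra hne
  exact h.sent_ne_top hi hj hx (by rw [(h.follows j hj).pref, if_neg hne])

theorem eq_of_propose {i j : Fin p.n}
    (hi : e.Honest i) (hj : e.Honest j) {k : Fin p.κ} {c : Option (Fin p.ell)} {b : Bool} {t : ℝ}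
    (hx : j ∈ e.senders i (.propose k c b) t) : e.proposal j k c = some b := by
  by_contra hne
  exact h.sent_ne_top hi hj hx (by rw [(h.follows j hj).propose, if_neg hne])

/-- The two quorums of preferences share an honest party, which sent a single preference. -/
theorem proposal_unique (hQ : QCondition 3 p.Z)
    {i j : Fin p.n} (hi : e.Honest i) (hj : e.Honest j) {k : Fin p.κ} {c : Option (Fin p.ell)}
    {b b' : Bool} (hb : e.proposal i k c = some b) (hb' : e.proposal j k c = some b') :
    b = b' := by
  obtain ⟨a, ha, h₁, h₂⟩ := h.exists_honest_mem_inter hQ (eq_some_of_pick hb) (eq_some_of_pick hb')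
  exact (h.eq_of_pref hi ha h₁).symm.trans (h.eq_of_pref hj ha h₂)

/-! ### Outputs -/

omit h in
theorem regularOut_eq_some {i : Fin p.n} {x : Bits p.ell} (hx : e.regularOut i = some x) :
    e.acast i p.TBC = some x := by
  unfold regularOut at hx
  split_ifs at hx
  exact hx

/-- A regular output other than `⊥` is already the Acast output at `T_BC`, and that is final. -/
theorem out_of_lt {i : Fin p.n} (hi : e.Honest i) {t : ℝ} (ht : p.TBC < t) :
    e.out i t = some (e.acast i t) := by
  rw [out, if_neg ht.not_gt, if_neg ht.ne']
  cases hr : e.regularOut i with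
  | none => rfl
  | some x => simp [(h.follows i hi).acast_final x _ _ ht.le (regularOut_eq_some hr)]

end Async

end Execution

/-! ### Number of kings -/

theorem Params.KingsValid.le_card {p : Params} (hK : p.KingsValid) : p.κ ≤ p.n := by
  simpa using Fintype.card_le_of_injective _ hK.1

/-- There is at least one phase. The execution is used to know that `Z` has a member, so that an
empty set of kings would be corruptible. -/
theorem Params.KingsValid.three_mul_le_TSBA {p : Params} (hK : p.KingsValid) {e : Execution p}
    (h : e.Async) (hΔ : 0 < p.Δ) : 3 * p.Δ ≤ p.TSBA := by
  obtain ⟨_, ⟨k, -⟩, -⟩ := h.exists_honest_of_not_corruptible hK.2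
  have : (1 : ℝ) ≤ p.κ := by exact_mod_cast (Nat.zero_le _).trans_lt k.isLt
  unfold Params.TSBA
  nlinarith

namespace Execution

variable {p : Params} {e : Execution p}

/-! ### Synchronous network: time bounds and agreement. -/

namespace Sync

variable (h : e.Sync)
include h

theorem mem_senders {i j : Fin p.n} (hi : e.Honest i) (hj : e.Honest j) {x : Msg p.ell p.κ}
    {s t : ℝ} (hs : e.sent j x ≤ (s : WithTop ℝ)) (hst : s + p.Δ ≤ t) : j ∈ e.senders i x t := by
  obtain ⟨r, hr, hrs⟩ := WithTop.le_coe_iff.1 hs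
  exact (h.delay i j hi hj x r hr).trans (WithTop.coe_le_coe.2 (by linarith))

theorem sent_le {i j : Fin p.n} (hi : e.Honest i) (hj : e.Honest j) {x : Msg p.ell p.κ} {t : ℝ}
    (hx : j ∈ e.senders i x t) : e.sent j x ≤ (t : WithTop ℝ) := by
  obtain ⟨r, hr, hrt⟩ := WithTop.le_coe_iff.1 hx
  obtain ⟨s, hs, hlt⟩ := h.authentic i j hi hj x r hr
  rw [h.clock_eq, h.clock_eq] at hlt
  exact hs ▸ WithTop.coe_le_coe.2 (hlt.le.trans hrt)

/-! ### Acast -/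

theorem acast_of_ready_le (hQ : QCondition 3 p.Z) {x : Bits p.ell} {s t : ℝ}
    (hx : ∀ j, e.Honest j → e.sent j (.ready x) ≤ (s : WithTop ℝ)) (hst : s + p.Δ ≤ t)
    {i : Fin p.n} (hi : e.Honest i) : e.acast i t = some x :=
  h.acast_of_ready_quorum hQ hi
    (h.containsCompl_of_honest fun j hj => h.mem_senders hi hj (hx j hj) hst)

/-- One `Δ` for the honest `ready`s behind the output of `i` to reach everybody and trigger `ready`,
another for those to arrive. -/
theorem acast_of_acast (hQ : QCondition 3 p.Z) {i j : Fin p.n} (hi : e.Honest i)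
    (hj : e.Honest j) {x : Bits p.ell} {s t : ℝ} (hx : e.acast i s = some x)
    (hst : s + 2 * p.Δ ≤ t) : e.acast j t = some x := by
  refine h.acast_of_ready_le hQ (s := s + p.Δ) (fun a ha => ?_) (by linarith) hj
  refine ((h.follows a ha).ready x _).2 (Or.inr ?_)
  exact h.not_corruptible_of_honest_subset hQ ((h.follows i hi).acast_some x s hx)
    fun b hb hbh => h.mem_senders ha hbh (h.sent_le hi hbh hb) le_rfl

/-- One `Δ` for each of `init`, `echo` and `ready`. -/
theorem acast_input (hQ : QCondition 3 p.Z) (hS : e.Honest p.S) {i : Fin p.n}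
    (hi : e.Honest i) : e.acast i (3 * p.Δ) = some p.m := by
  have hecho : ∀ j, e.Honest j → e.sent j (.echo p.m) ≤ (p.Δ : WithTop ℝ) := fun j hj =>
    h.echo_le hS hj (h.mem_senders hj hS (s := 0) (by simp [(h.follows p.S hS).init]) (by simp))
  refine h.acast_of_ready_le hQ (s := 2 * p.Δ) (fun j hj => ?_) (by linarith) hi
  exact ((h.follows j hj).ready _ _).2 (Or.inl (h.containsCompl_of_honest fun a ha =>
    h.mem_senders hj ha (hecho a ha) (by linarith)))

/-! ### Byzantine agreement -/

theorem mem_proposers {i j : Fin p.n} (hi : e.Honest i) (hj : e.Honest j) {k : Fin p.κ}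
    {c : Option (Fin p.ell)} {b : Bool} (hb : e.proposal j k c = some b) :
    j ∈ e.senders i (.propose k c b) (p.phaseStart k + 2 * p.Δ) :=
  h.mem_senders hi hj (by rw [(h.follows j hj).propose, if_pos hb]) (by linarith)

/-- The honest proposers seen by `i` are not corruptible and reach `j` in time as well; a rival bit
would need an honest proposer, contrary to `proposal_unique`. This ties an honest king to any quorum
seen by another honest party. -/
theorem midPref_eq (hQ : QCondition 3 p.Z) {i j : Fin p.n} (hi : e.Honest i) (hj : e.Honest j)
    {k : Fin p.κ} {c : Option (Fin p.ell)} {b : Bool}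
    (hb : ContainsCompl p.Z (e.senders i (.propose k c b) (p.phaseStart k + 2 * p.Δ)))
    (b₀ : Bool) : e.midPref j k c b₀ = b := by
  obtain ⟨a, hab, ha⟩ := h.exists_honest_mem hQ hb
  rw [midPref, pick_eq_some (b := b), Option.getD_some]
  · exact h.not_corruptible_of_honest_subset hQ hb fun a hab ha =>
      h.mem_proposers hj ha (h.eq_of_propose hi ha hab)
  · intro b' hb'
    obtain ⟨a', ha'b, ha'⟩ := h.exists_honest_of_not_corruptible hb'
    exact h.proposal_unique hQ ha' ha (h.eq_of_propose hj ha' ha'b) (h.eq_of_propose hi ha hab)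

theorem endPref_of_quorum (hQ : QCondition 3 p.Z) {i : Fin p.n} (hi : e.Honest i)
    {k : Fin p.κ} {c : Option (Fin p.ell)} {b : Bool}
    (hb : ContainsCompl p.Z (e.senders i (.propose k c b) (p.phaseStart k + 2 * p.Δ)))
    (b₁ : Bool) : e.endPref i k c b₁ = b := by
  rw [endPref, pick_eq_some hb]
  · rfl
  · intro b' hb'
    obtain ⟨a, ha, h₁, h₂⟩ := h.exists_honest_mem_inter hQ hb hb'
    exact Option.some_injective _
      ((h.eq_of_propose hi ha h₂).symm.trans (h.eq_of_propose hi ha h₁))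

/-- All honest parties propose the common bit, so each sees a quorum for it and ignores the king. -/
theorem prefAt_succ_of_agree (hQ : QCondition 3 p.Z) {c : Option (Fin p.ell)} {b : Bool} {k : ℕ}
    (hk : k < p.κ) (hb : ∀ i, e.Honest i → e.prefAt i c k hk.le = b) {i : Fin p.n}
    (hi : e.Honest i) : e.prefAt i c (k + 1) hk = b := by
  have hprop : ∀ j, e.Honest j → e.proposal j ⟨k, hk⟩ c = some b := fun j hj => by
    refine pick_eq_some (h.containsCompl_of_honest fun a ha => ?_) fun b' hb' => ?_
    · exact h.mem_senders hj ha (by rw [(h.follows a ha).pref, if_pos (hb a ha)]) le_rfl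
    · obtain ⟨a, hab, ha⟩ := h.exists_honest_mem hQ hb'
      exact (h.eq_of_pref hj ha hab).symm.trans (hb a ha)
  exact h.endPref_of_quorum hQ hi
    (h.containsCompl_of_honest fun a ha => h.mem_proposers hi ha (hprop a ha)) _

theorem prefAt_of_agree (hQ : QCondition 3 p.Z) {c : Option (Fin p.ell)} {b : Bool} {k : ℕ}
    (hk : k ≤ p.κ) (hb : ∀ i, e.Honest i → e.prefAt i c k hk = b) {k' : ℕ} (hkk' : k ≤ k')
    (hk' : k' ≤ p.κ) : ∀ i, e.Honest i → e.prefAt i c k' hk' = b := by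
  induction k', hkk' using Nat.le_induction with
  | base => exact hb
  | succ l _ ih => exact fun i hi => h.prefAt_succ_of_agree hQ hk' (ih (Nat.le_of_succ_le hk')) hi

theorem endPref_of_king {k : Fin p.κ} (hking : e.Honest (p.king k)) {i : Fin p.n}
    (hi : e.Honest i) {c : Option (Fin p.ell)}
    (hq : ∀ b, ¬ ContainsCompl p.Z
      (e.senders i (.propose k c b) (p.phaseStart k + 2 * p.Δ))) (b₁ : Bool) :
    e.endPref i k c b₁ =
      e.midPref (p.king k) k c (e.prefAt (p.king k) c k k.isLt.le) := by
  rw [endPref, show (pick fun b => ContainsCompl p.Z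
      (e.senders i (.propose k c b) (p.phaseStart k + 2 * p.Δ))) = none by simp [pick, hq],
    Option.orElse_none, pick_eq_some, Option.getD_some]
  · exact h.mem_senders hi hking (by rw [(h.follows _ hking).king, if_pos ⟨rfl, rfl⟩])
      (by linarith)
  · intro b hb
    by_contra hne
    refine h.sent_ne_top hi hking hb ?_
    rw [(h.follows _ hking).king, if_neg fun hc => hne hc.2.symm]

/-- The common bit is the one the king sends: a party without a quorum of proposals adopts it, and a
party with a quorum for `b` keeps `b`, which by `midPref_eq` is also the king's bit. -/
theorem exists_agree_of_king (hQ : QCondition 3 p.Z) {k : Fin p.κ} (hking : e.Honest (p.king k))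
    (c : Option (Fin p.ell)) : ∃ b, ∀ i, e.Honest i → e.prefAt i c (k + 1) k.isLt = b := by
  refine ⟨e.midPref (p.king k) k c (e.prefAt (p.king k) c k k.isLt.le), fun i hi => ?_⟩
  by_cases hq : ∃ b, ContainsCompl p.Z
      (e.senders i (.propose k c b) (p.phaseStart k + 2 * p.Δ))
  · obtain ⟨b, hb⟩ := hq
    exact (h.endPref_of_quorum hQ hi hb _).trans (h.midPref_eq hQ hi hking hb _).symm
  · exact h.endPref_of_king hking hi (fun b hb => hq ⟨b, hb⟩) _

theorem sbaOut_eq (hQ : QCondition 3 p.Z) (hK : p.KingsValid) {i j : Fin p.n} (hi : e.Honest i)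
    (hj : e.Honest j) : e.sbaOut i = e.sbaOut j := by
  obtain ⟨_, ⟨k, rfl⟩, hk⟩ := h.exists_honest_of_not_corruptible hK.2
  refine congrArg decode (funext fun c => ?_)
  obtain ⟨b, hb⟩ := h.exists_agree_of_king hQ hk c
  have := h.prefAt_of_agree hQ k.isLt hb k.isLt le_rfl
  rw [this i hi, this j hj]

theorem sbaOut_of_agree (hQ : QCondition 3 p.Z) {x : Option (Bits p.ell)}
    (hx : ∀ i, e.Honest i → e.acast i (3 * p.Δ) = x) {i : Fin p.n} (hi : e.Honest i) :
    e.sbaOut i = x := by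
  have : ∀ c, e.prefAt i c p.κ le_rfl = encode x c := fun c =>
    h.prefAt_of_agree hQ (Nat.zero_le _) (fun j hj => by rw [prefAt, hx j hj])
      (Nat.zero_le _) le_rfl i hi
  simp only [sbaOut, this]
  cases x <;> simp [decode, encode]

/-- Otherwise all honest inputs to the agreement are `⊥`, and agreement on `⊥` persists. -/
theorem exists_acast_of_sbaOut (hQ : QCondition 3 p.Z) {i : Fin p.n} (hi : e.Honest i)
    (hx : e.sbaOut i ≠ none) : ∃ j y, e.Honest j ∧ e.acast j (3 * p.Δ) = some y := by
  by_contra! hc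
  exact hx (h.sbaOut_of_agree hQ
    (fun j hj => Option.eq_none_iff_forall_ne_some.2 fun y => hc j y hj) hi)

/-! ### Outputs -/

theorem regularOut_eq (hQ : QCondition 3 p.Z) (hK : p.KingsValid) (hΔ : 0 < p.Δ) {i j : Fin p.n}
    (hi : e.Honest i) (hj : e.Honest j) : e.regularOut i = e.regularOut j := by
  have hsba := h.sbaOut_eq hQ hK hi hj
  cases hx : e.sbaOut j with
  | none =>
    have key : ∀ a, e.sbaOut a = none → e.regularOut a = none := fun a ha => by
      unfold regularOut
      split_ifs with hc
      exacts [hc.trans ha, rfl]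
    rw [key i (hsba.trans hx), key j hx]
  | some x =>
    -- The agreed value `x` need not be `y`; it is enough that `i` and `j` both hold `y` at `T_BC`
    -- and compare it with the same `x`.
    obtain ⟨a, y, ha, hay⟩ := h.exists_acast_of_sbaOut hQ hj (by simp [hx])
    have hT : 3 * p.Δ + 2 * p.Δ ≤ p.TBC := by
      have := hK.three_mul_le_TSBA h.toAsync hΔ
      unfold Params.TBC
      linarith
    simp only [regularOut, hsba, h.acast_of_acast hQ ha hi hay hT,
      h.acast_of_acast hQ ha hj hay hT]

theorem regularOut_input (hQ : QCondition 3 p.Z) (hΔ : 0 < p.Δ) (hS : e.Honest p.S) {i : Fin p.n}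
    (hi : e.Honest i) : e.regularOut i = some p.m := by
  have hT : 3 * p.Δ ≤ p.TBC := by
    unfold Params.TBC Params.TSBA
    have : 0 ≤ 3 * p.κ * p.Δ := by positivity
    linarith
  have ha := (h.follows i hi).acast_final _ _ _ hT (h.acast_input hQ hS hi)
  rw [regularOut, h.sbaOut_of_agree hQ (fun j hj => h.acast_input hQ hS hj) hi, ha, if_pos rfl]

end Sync

/-! ### Communication -/

/-- The only messages that a party that follows the protocol can send, if `x`, `y`, `z` are the
contents of its `init`, `echo` and `ready` messages. -/
noncomputable def possibleMsg (e : Execution p) (i : Fin p.n) (x y z : Bits p.ell) :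
    Fin 3 ⊕ Fin 3 × Fin p.κ × Option (Fin p.ell) → Msg p.ell p.κ
  | .inl 0 => .init x
  | .inl 1 => .echo y
  | .inl 2 => .ready z
  | .inr (0, k, c) => .pref k c (e.prefAt i c k k.isLt.le)
  | .inr (1, k, c) => .propose k c ((e.proposal i k c).getD false)
  | .inr (2, k, c) => .king k c (e.midPref i k c (e.prefAt i c k k.isLt.le))

theorem Async.exists_possibleMsg (h : e.Async) (hQ : QCondition 3 p.Z) {i : Fin p.n}
    (hi : e.Honest i) : ∃ x y z, ∀ w, e.sent i w ≠ ⊤ → w ∈ Set.range (e.possibleMsg i x y z) := by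
  have hf := h.follows i hi
  obtain ⟨y, hy⟩ : ∃ y, ∀ y', e.sent i (.echo y') ≠ ⊤ → y' = y := by
    by_cases hc : ∃ y, e.sent i (.echo y) ≠ ⊤
    · exact hc.imp fun y hy y' hy' => hf.echo_once y' y hy' hy
    · exact ⟨p.m, fun y' hy' => absurd ⟨y', hy'⟩ hc⟩
  -- The rule for `ready` alone does not limit a party to one message; quorum intersection does.
  obtain ⟨z, hz⟩ : ∃ z, ∀ z', e.sent i (.ready z') ≠ ⊤ → z' = z := by
    by_cases hc : ∃ z, e.sent i (.ready z) ≠ ⊤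
    · exact hc.imp fun z hz z' hz' => h.ready_unique hQ hi hi hz' hz
    · exact ⟨p.m, fun z' hz' => absurd ⟨z', hz'⟩ hc⟩
  refine ⟨p.m, y, z, fun w hw => ?_⟩
  cases w with
  | init x =>
    rw [hf.init] at hw
    split_ifs at hw with hc
    · exact ⟨.inl 0, by rw [hc.2]; rfl⟩
    · exact absurd rfl hw
  | echo y' => exact ⟨.inl 1, by rw [hy y' hw]; rfl⟩
  | ready z' => exact ⟨.inl 2, by rw [hz z' hw]; rfl⟩
  | pref k c b =>
    rw [hf.pref] at hw
    split_ifs at hw with hc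
    · exact ⟨.inr (0, k, c), by rw [← hc]; rfl⟩
    · exact absurd rfl hw
  | propose k c b =>
    rw [hf.propose] at hw
    split_ifs at hw with hc
    · exact ⟨.inr (1, k, c), by simp [possibleMsg, hc]⟩
    · exact absurd rfl hw
  | king k c b =>
    rw [hf.king] at hw
    split_ifs at hw with hc
    · exact ⟨.inr (2, k, c), by rw [← hc.2]; rfl⟩
    · exact absurd rfl hw

/-- At most `n` senders, `n` recipients, three Acast messages, and three messages of four bits for
each phase and instance. Summing over indices instead of distinct messages only increases the total.
-/
theorem Async.honestBits_le (h : e.Async) (hQ : QCondition 3 p.Z) :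
    e.honestBits ≤ p.n * (p.n * (3 * (3 + p.ell) + 3 * (p.κ * (p.ell + 1)) * 4)) := by
  classical
  refine (Finset.sum_le_card_nsmul _ _
    (p.n * (3 * (3 + p.ell) + 3 * (p.κ * (p.ell + 1)) * 4)) fun i hi => ?_).trans ?_
  · obtain ⟨x, y, z, hw⟩ := h.exists_possibleMsg hQ (Finset.mem_filter.1 hi).2
    calc (∑ w : Msg p.ell p.κ, if e.sent i w = ⊤ then 0 else p.n * w.bits)
        = ∑ w ∈ Finset.univ.filter fun w => e.sent i w ≠ ⊤, p.n * w.bits := by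
          simp [Finset.sum_filter]
      _ ≤ ∑ w ∈ Finset.univ.image (e.possibleMsg i x y z), p.n * w.bits := by
          refine Finset.sum_le_sum_of_subset fun w hw' => ?_
          obtain ⟨a, rfl⟩ := hw w (Finset.mem_filter.1 hw').2
          exact Finset.mem_image_of_mem _ (Finset.mem_univ a)
      _ ≤ ∑ a, p.n * (e.possibleMsg i x y z a).bits :=
          Finset.sum_image_le_of_nonneg fun _ _ => Nat.zero_le _
      _ = p.n * (3 * (3 + p.ell) + 3 * (p.κ * (p.ell + 1)) * 4) := by
          rw [← Finset.mul_sum, Fintype.sum_sum_type, Fintype.sum_prod_type]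
          simp only [Fin.sum_univ_three, possibleMsg, Msg.bits, Finset.sum_const,
            Finset.card_univ, Fintype.card_prod, Fintype.card_option, Fintype.card_fin,
            smul_eq_mul]
          ring
  · rw [smul_eq_mul]
    exact Nat.mul_le_mul_right _ ((Finset.card_le_univ _).trans (Fintype.card_fin _).le)

end Execution

end BestOfBothBC

/-! ### Assembly of the theorem. -/

open BestOfBothBC in
theorem mainTheorem4 :
    ∃ C : ℕ, ∀ p : Params, QCondition 3 p.Z → p.KingsValid → 0 < p.Δ →
      -- the running time
      (p.TBC = 3 * p.Δ + p.TSBA ∧ p.TSBA ≤ 3 * p.n * p.Δ) ∧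
      -- communication complexity, in either network
      (1 ≤ p.ell → ∀ e : Execution p, e.Sync ∨ e.Async →
        e.honestBits ≤ C * (p.n ^ 3 * p.ell)) ∧
      -- synchronous network
      (∀ e : Execution p, e.Sync →
        -- liveness
        (∀ i, e.Honest i → ∃ y, e.out i p.TBC = some y) ∧
        -- validity
        (e.Honest p.S → ∀ i, e.Honest i → e.out i p.TBC = some (some p.m)) ∧
        -- consistency
        (¬ e.Honest p.S → ∀ i j, e.Honest i → e.Honest j →
          e.out i p.TBC = e.out j p.TBC) ∧
        -- fallback consistency
        (¬ e.Honest p.S → ∀ i T x, e.Honest i → e.FallbackOutput i T x →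
          ∀ j, e.Honest j → ∀ t, T + 2 * p.Δ ≤ t → e.out j t = some (some x))) ∧
      -- asynchronous network
      (∀ e : Execution p, e.Async →
        -- liveness
        (∀ i, e.Honest i → ∃ y, e.out i p.TBC = some y) ∧
        -- weak validity
        (e.Honest p.S → ∀ i, e.Honest i →
          e.out i p.TBC = some (some p.m) ∨ e.out i p.TBC = some none) ∧
        -- fallback validity
        (e.Honest p.S → ∀ i, e.Honest i → e.out i p.TBC = some none →
          (∃ T, e.FallbackOutput i T p.m) ∧ e.EventuallyOutputs i p.m) ∧
        -- weak consistency
        (¬ e.Honest p.S → ∃ x, ∀ i, e.Honest i →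
          e.out i p.TBC = some (some x) ∨ e.out i p.TBC = some none) ∧
        -- fallback consistency
        (¬ e.Honest p.S → ∀ i T x, e.Honest i → p.TBC ≤ T → e.out i T = some (some x) →
          ∀ j, e.Honest j → e.EventuallyOutputs j x)) := by
  -- With `3 ≤ 3ℓ`, `1 ≤ ℓ` and `κ ≤ n`, Acast contributes `3 · 4 = 12` and the agreement `3 · 2 · 4
  -- = 24`.
  refine ⟨36, fun p hQ hK hΔ => ⟨⟨rfl, ?_⟩, ?_, ?_, ?_⟩⟩
  · have : (p.κ : ℝ) ≤ p.n := by exact_mod_cast hK.le_card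
    unfold Params.TSBA
    gcongr
  · intro hℓ e he
    have h : e.Async := he.elim (fun h => h.toAsync) id
    have hn : 1 ≤ p.n := (Nat.zero_le _).trans_lt p.S.isLt
    calc e.honestBits
        ≤ p.n * (p.n * (3 * (3 + p.ell) + 3 * (p.κ * (p.ell + 1)) * 4)) := h.honestBits_le hQ
      _ ≤ p.n * (p.n * (3 * (p.n * (3 * p.ell + p.ell)) + 3 * (p.n * (p.ell + p.ell)) * 4)) := by
          gcongr
          · exact (show 3 + p.ell ≤ 3 * p.ell + p.ell by omega).trans (Nat.le_mul_of_pos_left _ hn)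
          · exact hK.le_card
      _ = 36 * (p.n ^ 3 * p.ell) := by ring
  · intro e h
    have hout : ∀ i, e.out i p.TBC = some (e.regularOut i) := fun i => by simp [Execution.out]
    refine ⟨fun i _ => ⟨_, hout i⟩, fun hS i hi => ?_, fun _ i j hi hj => ?_, ?_⟩
    · rw [hout, h.regularOut_input hQ hΔ hS hi]
    · rw [hout, hout, h.regularOut_eq hQ hK hΔ hi hj]
    · rintro - i T x hi ⟨hT, -, hx⟩ j hj t ht
      rw [h.out_of_lt hi hT] at hx
      rw [h.out_of_lt hj (by linarith), h.acast_of_acast hQ hi hj (Option.some_injective _ hx) ht]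
  · intro e h
    have hout : ∀ i, e.out i p.TBC = some (e.regularOut i) := fun i => by simp [Execution.out]
    have hacast : ∀ i x, e.out i p.TBC = some (some x) → e.acast i p.TBC = some x :=
      fun i x hx => Execution.Async.regularOut_eq_some
        (Option.some_injective _ ((hout i).symm.trans hx))
    have hcases : ∀ i, e.out i p.TBC = some none ∨ ∃ x, e.out i p.TBC = some (some x) := fun i => by
      rw [hout]
      cases e.regularOut i <;> simp
    -- The `+ 1` only serves to be strictly past `T_BC`, where `out_of_lt` applies.
    have hlater : ∀ i x t, e.Honest i → e.acast i t = some x →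
        ∀ t', max t (p.TBC + 1) ≤ t' → e.out i t' = some (some x) := fun i x t hi hx t' ht' => by
      rw [h.out_of_lt hi (by linarith [le_max_right t (p.TBC + 1)]),
        (h.follows i hi).acast_final x t t' ((le_max_left _ _).trans ht') hx]
    refine ⟨fun i _ => ⟨_, hout i⟩, fun hS i hi => ?_, fun hS i hi hbot => ?_, fun _ => ?_,
      fun _ i T x hi hT hx j hj => ?_⟩
    · rcases hcases i with hc | ⟨x, hx⟩
      · exact Or.inr hc
      · exact Or.inl (h.acast_eq_input hQ hS hi (hacast i x hx) ▸ hx)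
    · obtain ⟨t, ht⟩ := h.exists_acast_input hQ hS hi
      have := hlater i p.m t hi ht
      exact ⟨⟨_, by linarith [le_max_right t (p.TBC + 1)], hbot, this _ le_rfl⟩, _, this⟩
    · by_cases hc : ∃ i x, e.Honest i ∧ e.out i p.TBC = some (some x)
      · obtain ⟨i, x, hi, hx⟩ := hc
        refine ⟨x, fun j hj => (hcases j).symm.imp_left ?_⟩
        rintro ⟨y, hy⟩
        rw [hy, h.acast_unique hQ hi hj (hacast i x hx) (hacast j y hy)]
      -- All honest outputs are `⊥` here, so any message would do as witness.
      · exact ⟨p.m, fun j hj => (hcases j).symm.imp_left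
          fun ⟨y, hy⟩ => absurd ⟨j, y, hj, hy⟩ hc⟩
    · have hix : e.acast i T = some x := by
        rcases hT.eq_or_lt with rfl | hT
        · exact hacast i x hx
        · exact Option.some_injective _ ((h.out_of_lt hi hT).symm.trans hx)
      obtain ⟨t, ht⟩ := h.exists_acast_of_acast hQ hi hj hix
      exact ⟨_, hlater j x t hj ht⟩
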